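/- **Notation.** Let $U$ be a finite set. A statistical query is a function $q:U\to\mathbb R$; on a dataset $x=(x_1,\dots,x_n)\in U^n$ its value is $q(x)=\frac1n\sum_{i=1}^n q(x_i)$. The query matrix $Q$ of a sequence $\mathcal Q=(q_1,\dots,q_m)$ has the table of values of $q_t$ as its $t$-th row, and $Q_t$ consists of the first $t$ rows of $Q$. For a real matrix $A$, $\gamma_2(A)=\min\{\|L\|_{2\to\infty}\|R\|_{1\to2}: LR=A\}$, where $\|L\|_{2\to\infty}$ is the maximum Euclidean norm of a row of $L$ and $\|R\|_{1\to 2}$ the maximum Euclidean norm of a column of $R$. An interactive algorithm holds a dataset $x\in U^n$, receives queries one at a time, and answers each query by a real number that may depend on $x$, on the queries received so far and on its random coins, but not on later queries. It is $(\varepsilon,\delta)$-differentially private if, for every sequence of queries $q_1,\dots,q_m$ fixed in advance, all $x,x'\in U^n$ that differ in exactly one data point and every measurable $S\subseteq\mathbb R^m$, its answers satisfy $\Pr[a(x)\in S]\le e^{\varepsilon}\Pr[a(x')\in S]+\delta$. **Theorem.** For every positive integer $N$ there is a sequence $\mathcal Q=\mathcal Q^{(N)}=(q_1,\dots,q_N)$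 of statistical queries on the universe $U=\{1,\dots,N\}$, with $N\times N$ query matrix $Q$, such that $\|q_1\|_\infty=1$; there are absolute constants $a,b>0$ with $aN\le\log_2\gamma_2(Q)\le bN$ for all $N\ge2$; for $N$ a power of two, $q_t=2^{(t-1)/2}h_t$ where $h_1,\dots,h_N$ are the rows of a Hadamard matrix; and the following lower bounds hold. For $\varepsilon>0$ and $c>0$, consider the statement $(\ast)$ there is $n_0$ such that for every $n\ge n_0$, every $(\varepsilon,\delta)$-differentially private interactive algorithm $M$ on datasets of size $n$ over $U$, and every real $C$: if for every $x\in U^n$ the answers $a_1,\dots,a_N$ of $M$ to the queries $q_1,\dots,q_N$, given online, satisfy with probability at least $\frac23$ $$|q_t(x)-a_t|\le\frac{C\,\gamma_2(Q_t)}{\varepsilon n}\qquad\text{for all }t\in\{1,\dots,N\},$$ then $C\ge c\sqrt{\log_2\gamma_2(Q)}$. 1. There are absolute constants $c,\eta>0$ such that $(\ast)$ holds for all $N\ge1$, all $\varepsilon\in(0,1]$ and all $\delta\in[0,\eta\varepsilon]$. 2. For all $\varepsilon>0$ and $\delta\in[0,\frac23)$ there are $c>0$ and $N_0$, depending only on $\varepsilon$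 and $\delta$, such that $(\ast)$ holds for all $N\ge N_0$. -/

import Mathlib

open MeasureTheory

universe u v

noncomputable section

/-- `‖L‖_{2→∞}`: the largest Euclidean norm of a row of `L`. -/
def maxRowNorm {m k : Type*} [Fintype k] (L : Matrix m k ℝ) : ℝ :=
  ⨆ i, Real.sqrt (∑ j, L i j ^ 2)

/-- `‖R‖_{1→2}`: the largest Euclidean norm of a column of `R`. -/
def maxColNorm {k n : Type*} [Fintype k] (R : Matrix k n ℝ) : ℝ :=
  ⨆ j, Real.sqrt (∑ i, R i j ^ 2)

/-- The factorization norm `γ₂(A)`: the least value of `‖L‖_{2→∞} ‖R‖_{1→2}` over all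
factorizations `A = L R` through some `ℝ^k`. -/
def gammaTwo {m n : Type*} (A : Matrix m n ℝ) : ℝ :=
  sInf {r : ℝ | ∃ (k : ℕ) (L : Matrix m (Fin k) ℝ) (R : Matrix (Fin k) n ℝ),
    L * R = A ∧ r = maxRowNorm L * maxColNorm R}

/-- The answer `q(x) = (1/n) ∑ᵢ q(xᵢ)` of the statistical query `q : U → ℝ` on a dataset `x`. -/
def queryAnswer {U : Type*} {n : ℕ} (q : U → ℝ) (x : Fin n → U) : ℝ :=
  (∑ i, q (x i)) / n

/-- The query matrix of a sequence of queries: the `t`-th row is the table of values of `q_t`. -/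
def queryMatrix {U : Type*} {m : ℕ} (q : Fin m → U → ℝ) : Matrix (Fin m) U ℝ :=
  Matrix.of q

/-- `Q_t`: the rows of the query matrix up to and including row `t`. -/
def queryPrefix {U : Type*} {m : ℕ} (q : Fin m → U → ℝ) (t : Fin m) :
    Matrix {i : Fin m // i ≤ t} U ℝ :=
  (queryMatrix q).submatrix Subtype.val id

/-- Two datasets of size `n` are neighboring if they differ in exactly one data point. -/
def Neighboring {U : Type*} {n : ℕ} (x x' : Fin n → U) : Prop :=
  ∃! i, x i ≠ x' i

/-- `(ε, δ)`-differential privacy of a randomized algorithm, given by its output law on each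
dataset of size `n`. -/
def IsDifferentiallyPrivate {U R : Type*} [MeasurableSpace R] {n : ℕ}
    (law : (Fin n → U) → Measure R) (ε δ : ℝ) : Prop :=
  ∀ x x' : Fin n → U, Neighboring x x' → ∀ S : Set R, MeasurableSet S →
    (law x).real S ≤ Real.exp ε * (law x').real S + δ

/-- A randomized interactive algorithm on datasets of size `n` over the universe `U`, answering
statistical queries that arrive one at a time. Its coins are a point `ω` of a probability space,
drawn once; the answer to the most recent query is a function of the dataset, of the queries
received so far (in order of arrival, the most recent one last), and of the coins. It depends
neither on later queries nor on their number. -/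
structure InteractiveAlgorithm (U : Type v) (n : ℕ) where
  Ω : Type u
  [measurableSpace : MeasurableSpace Ω]
  coins : Measure Ω
  [isProbabilityMeasure : IsProbabilityMeasure coins]
  answer : (Fin n → U) → List (U → ℝ) → Ω → ℝ
  measurable_answer : ∀ x l, Measurable (answer x l)

attribute [instance] InteractiveAlgorithm.measurableSpace
attribute [instance] InteractiveAlgorithm.isProbabilityMeasure

namespace InteractiveAlgorithm

variable {U : Type v} {n : ℕ}

/-- The answers `(a_1, …, a_m)` when the queries `q_1, …, q_m` are given one after the other. -/
def answers (M : InteractiveAlgorithm.{u, v} U n) (x : Fin n → U) {m : ℕ}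
    (q : Fin m → U → ℝ) (ω : M.Ω) : Fin m → ℝ :=
  fun t => M.answer x ((List.ofFn q).take (t + 1)) ω

/-- The law of the answers given to the queries `q_1, …, q_m` on the dataset `x`. -/
def transcriptLaw (M : InteractiveAlgorithm.{u, v} U n) {m : ℕ} (q : Fin m → U → ℝ)
    (x : Fin n → U) : Measure (Fin m → ℝ) :=
  M.coins.map (M.answers x q)

/-- `(ε, δ)`-differential privacy for non-adaptive analysts: for every sequence of queries fixed in
advance, the transcript is `(ε, δ)`-differentially private as a function of the dataset. -/
def IsPrivate (M : InteractiveAlgorithm.{u, v} U n) (ε δ : ℝ) : Prop :=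
  ∀ (m : ℕ) (q : Fin m → U → ℝ), IsDifferentiallyPrivate (M.transcriptLaw q) ε δ

/-- On every dataset `x`, with probability at least `2/3`, the answers to the queries `q` satisfy
`|q_t(x) - a_t| ≤ C γ₂(Q_t) / (ε n)` for all `t`. -/
def IsAccurate (M : InteractiveAlgorithm.{u, v} U n) {m : ℕ} (q : Fin m → U → ℝ)
    (ε C : ℝ) : Prop :=
  ∀ x : Fin n → U,
    2 / 3 ≤ M.coins.real {ω | ∀ t : Fin m,
      |queryAnswer (q t) x - M.answers x q ω t| ≤ C * gammaTwo (queryPrefix q t) / (ε * n)}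

end InteractiveAlgorithm

/-- For all large enough `n`, every `(ε, δ)`-differentially private interactive algorithm on
datasets of size `n` which answers `q` online with error `C γ₂(Q_t) / (ε n)` has
`C ≥ c √(log₂ γ₂(Q))`. -/
def ErrorFactorAtLeast {U : Type v} {m : ℕ} (q : Fin m → U → ℝ) (ε δ c : ℝ) : Prop :=
  ∃ n₀ : ℕ, ∀ n ≥ n₀, ∀ M : InteractiveAlgorithm.{u, v} U n, M.IsPrivate ε δ →
    ∀ C : ℝ, M.IsAccurate q ε C →
      c * Real.sqrt (Real.logb 2 (gammaTwo (queryMatrix q))) ≤ C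

end

noncomputable section

/-! ### The factorization norm -/

/-! The geometric scaling makes each prefix norm comparable to its last row: the squared column
norms of `Q_t` are geometric sums, so with rows counted from `0`, `γ₂(Q_t) ≤ √2 · √2 ^ t`
(`gammaTwo_queryPrefix_le`). An accurate algorithm therefore reveals every Hadamard coefficient of
the histogram up to the same error `√2 C / ε`. Inverting an `M × M` Hadamard matrix turns mean
squared error in the coefficients into total squared error in the histogram
(`Matrix.IsHadamard.sum_sq_reconstruct_sub`): all `M` bins together are off by at most `2 C² / ε²`.
Since `log₂ γ₂(Q)` is of order `M`, a small ratio `C / √(log₂ γ₂(Q))` means that most bins are known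
to within a small multiple of `1 / ε`, which privacy forbids.

The contradiction comes from planting a word in disjoint blocks of bins and decoding it
(`exists_decoding_events`). Averaging over all words isolates one block whose letters are decoded
with average probability almost `2 / 3`. For `ε ≤ 1`, a block is one bin and its letters are six
multiples of about `1 / ε` data points; group privacy between consecutive letters caps the average
at `3.92 / 6` (`sum_measureReal_path_le`). For general `ε` and `δ < 2 / 3`, a block has `K` bins and
the letter is the location of a single data point, so the average is at most `exp ε / K + δ`, which
is below `2 / 3` for large `K`. -/

theorem sqrt_sum_sq_le_maxRowNorm {m k : Type*} [Finite m] [Fintype k] (L : Matrix m k ℝ) (i : m) :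
    Real.sqrt (∑ j, L i j ^ 2) ≤ maxRowNorm L :=
  le_ciSup (f := fun i => Real.sqrt (∑ j, L i j ^ 2)) (Set.finite_range _).bddAbove i

theorem sqrt_sum_sq_le_maxColNorm {k n : Type*} [Fintype k] [Finite n] (R : Matrix k n ℝ) (j : n) :
    Real.sqrt (∑ i, R i j ^ 2) ≤ maxColNorm R :=
  le_ciSup (f := fun j => Real.sqrt (∑ i, R i j ^ 2)) (Set.finite_range _).bddAbove j

theorem maxRowNorm_nonneg {m k : Type*} [Fintype k] (L : Matrix m k ℝ) : 0 ≤ maxRowNorm L :=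
  Real.iSup_nonneg fun _ => Real.sqrt_nonneg _

theorem maxColNorm_nonneg {k n : Type*} [Fintype k] (R : Matrix k n ℝ) : 0 ≤ maxColNorm R :=
  Real.iSup_nonneg fun _ => Real.sqrt_nonneg _

/-- The trivial factorization `A = 1 * A`. It also shows that the infimum defining `γ₂` runs over a
nonempty set. -/
theorem gammaTwo_factorization {m n : Type*} [Fintype m] (A : Matrix m n ℝ) :
    ∃ (L : Matrix m (Fin (Fintype.card m)) ℝ) (R : Matrix (Fin (Fintype.card m)) n ℝ),
      L * R = A ∧ maxRowNorm L ≤ 1 ∧ ∀ j, ∑ i, R i j ^ 2 = ∑ i, A i j ^ 2 := by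
  classical
  set f := Fintype.equivFin m
  refine ⟨Matrix.of fun i j => if f i = j then 1 else 0, Matrix.of fun i j => A (f.symm i) j,
    ?_, ?_, ?_⟩
  · ext i j
    simp [Matrix.mul_apply]
  · refine Real.iSup_le (fun i => ?_) zero_le_one
    simp
  · intro j
    exact Equiv.sum_comp f.symm fun i => A i j ^ 2

/-- Factoring through the identity: `γ₂` is at most the largest Euclidean norm of a column. -/
theorem gammaTwo_le {m n : Type*} [Fintype m] (A : Matrix m n ℝ) {s : ℝ} (hs : 0 ≤ s)
    (h : ∀ j, ∑ i, A i j ^ 2 ≤ s ^ 2) : gammaTwo A ≤ s := by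
  obtain ⟨L, R, hLR, hL, hR⟩ := gammaTwo_factorization A
  have hbdd : BddBelow {r : ℝ | ∃ (k : ℕ) (L : Matrix m (Fin k) ℝ) (R : Matrix (Fin k) n ℝ),
      L * R = A ∧ r = maxRowNorm L * maxColNorm R} := by
    refine ⟨0, ?_⟩
    rintro r ⟨k, L, R, -, rfl⟩
    exact mul_nonneg (maxRowNorm_nonneg L) (maxColNorm_nonneg R)
  refine (csInf_le hbdd ⟨_, L, R, hLR, rfl⟩).trans ?_
  have hR' : maxColNorm R ≤ s := by
    refine Real.iSup_le (fun j => ?_) hs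
    rw [hR j]
    exact Real.sqrt_le_iff.2 ⟨hs, h j⟩
  calc maxRowNorm L * maxColNorm R ≤ 1 * s :=
        mul_le_mul hL hR' (maxColNorm_nonneg R) zero_le_one
    _ = s := one_mul s

/-- Cauchy–Schwarz for a row of `L` against a column of `R`, in every factorization. -/
theorem abs_apply_le_gammaTwo {m n : Type*} [Fintype m] [Finite n] (A : Matrix m n ℝ)
    (i : m) (j : n) : |A i j| ≤ gammaTwo A := by
  obtain ⟨L, R, hLR, -, -⟩ := gammaTwo_factorization A
  refine le_csInf ⟨_, _, L, R, hLR, rfl⟩ ?_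
  rintro r ⟨k, L, R, rfl, rfl⟩
  calc |(L * R) i j| ≤ Real.sqrt (∑ l, L i l ^ 2) * Real.sqrt (∑ l, R l j ^ 2) := by
        rw [Matrix.mul_apply, abs_le]
        constructor
        · have := Real.sum_mul_le_sqrt_mul_sqrt Finset.univ (fun l => - L i l) (fun l => R l j)
          simp only [neg_mul, Finset.sum_neg_distrib, neg_sq] at this
          linarith
        · exact Real.sum_mul_le_sqrt_mul_sqrt Finset.univ (fun l => L i l) (fun l => R l j)
    _ ≤ maxRowNorm L * maxColNorm R :=
        mul_le_mul (sqrt_sum_sq_le_maxRowNorm L i) (sqrt_sum_sq_le_maxColNorm R j)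
          (Real.sqrt_nonneg _) (maxRowNorm_nonneg L)

/-! ### Hadamard matrices -/

theorem exists_isHadamard_two_pow (k : ℕ) :
    ∃ H : Matrix (Fin (2 ^ k)) (Fin (2 ^ k)) ℝ, H.IsHadamard := by
  induction k with
  | zero =>
    refine ⟨1, ⟨fun i j => ?_, ?_, ?_⟩⟩
    · have : i = j := by ext; have := i.2; have := j.2; omega
      subst this
      simp
    · ext; simp
    · ext; simp
  | succ k ih =>
    obtain ⟨H, hH⟩ := ih
    -- Sylvester's doubling: the Kronecker product with this matrix is again Hadamard.
    have h2 : (!![1, 1; 1, -1] : Matrix (Fin 2) (Fin 2) ℝ).IsHadamard := by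
      refine ⟨fun i j => ?_, ?_, ?_⟩
      · fin_cases i <;> fin_cases j <;> simp [Unitary.mem_iff]
      · ext i j
        fin_cases i <;> fin_cases j <;> norm_num [Matrix.mul_apply]
      · ext i j
        fin_cases i <;> fin_cases j <;> norm_num [Matrix.mul_apply]
    let e : Fin (2 ^ k) × Fin 2 ≃ Fin (2 ^ (k + 1)) :=
      finProdFinEquiv.trans (finCongr (pow_succ 2 k).symm)
    exact ⟨_, (hH.kronecker h2).reindex e e⟩

theorem Matrix.IsHadamard.sq_apply {m : Type*} [Fintype m] [DecidableEq m] {H : Matrix m m ℝ}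
    (hH : H.IsHadamard) (i j : m) : H i j ^ 2 = 1 := by
  have := (Unitary.mem_iff.1 (hH.apply_mem i j)).1
  rw [sq]
  simpa using this

theorem Matrix.IsHadamard.sum_row_mul_row {m : Type*} [Fintype m] [DecidableEq m]
    {H : Matrix m m ℝ} (hH : H.IsHadamard) (s t : m) :
    ∑ u, H s u * H t u = if s = t then (Fintype.card m : ℝ) else 0 := by
  have := congrFun (congrFun hH.mul_conjTranspose s) t
  simpa [Matrix.mul_apply, Matrix.one_apply] using this

theorem Matrix.IsHadamard.sum_col_mul_col {m : Type*} [Fintype m] [DecidableEq m]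
    {H : Matrix m m ℝ} (hH : H.IsHadamard) (u v : m) :
    ∑ t, H t u * H t v = if u = v then (Fintype.card m : ℝ) else 0 := by
  have := congrFun (congrFun hH.conjTranspose_mul u) v
  simpa [Matrix.mul_apply, Matrix.one_apply] using this

/-- Parseval's identity: the rows are orthogonal with squared norm `Fintype.card m`. -/
theorem Matrix.IsHadamard.sum_sq_vecMul {m : Type*} [Fintype m] [DecidableEq m]
    {H : Matrix m m ℝ} (hH : H.IsHadamard) (e : m → ℝ) :
    ∑ u, (∑ t, H t u * e t) ^ 2 = Fintype.card m * ∑ t, e t ^ 2 := by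
  calc ∑ u, (∑ t, H t u * e t) ^ 2
      = ∑ u, ∑ s, ∑ t, (H s u * H t u) * (e s * e t) := by
        refine Finset.sum_congr rfl fun u _ => ?_
        rw [sq, Finset.sum_mul_sum]
        refine Finset.sum_congr rfl fun s _ => Finset.sum_congr rfl fun t _ => by ring
    _ = ∑ s, ∑ t, (∑ u, H s u * H t u) * (e s * e t) := by
        rw [Finset.sum_comm]
        refine Finset.sum_congr rfl fun s _ => ?_
        rw [Finset.sum_comm]
        refine Finset.sum_congr rfl fun t _ => ?_
        rw [Finset.sum_mul]
    _ = Fintype.card m * ∑ t, e t ^ 2 := by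
        simp only [hH.sum_row_mul_row, ite_mul, zero_mul, Finset.sum_ite_eq, Finset.mem_univ,
          if_true, Finset.mul_sum, sq]

/-- Inverting a Hadamard matrix on noisy measurements: the squared error of the reconstruction is
the mean squared error of the measurements. -/
theorem Matrix.IsHadamard.sum_sq_reconstruct_sub {m : Type*} [Fintype m] [DecidableEq m]
    [Nonempty m] {H : Matrix m m ℝ} (hH : H.IsHadamard) (z y : m → ℝ) :
    ∑ u, ((∑ t, H t u * y t) / Fintype.card m - z u) ^ 2 =
      (∑ t, (y t - ∑ v, H t v * z v) ^ 2) / Fintype.card m := by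
  have hm : (Fintype.card m : ℝ) ≠ 0 := by positivity
  have hz : ∀ u, z u = (∑ t, H t u * ∑ v, H t v * z v) / Fintype.card m := by
    intro u
    rw [eq_div_iff hm]
    simp only [Finset.mul_sum, ← mul_assoc]
    rw [Finset.sum_comm]
    simp only [← Finset.sum_mul, hH.sum_col_mul_col, ite_mul, zero_mul, Finset.sum_ite_eq,
      Finset.mem_univ, if_true]
    ring
  have hu : ∀ u, ((∑ t, H t u * y t) / Fintype.card m - z u) ^ 2 =
      (∑ t, H t u * (y t - ∑ v, H t v * z v)) ^ 2 / (Fintype.card m : ℝ) ^ 2 := by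
    intro u
    conv_lhs => rw [hz u]
    rw [← sub_div, div_pow]
    simp only [mul_sub, Finset.sum_sub_distrib]
  simp only [hu, ← Finset.sum_div]
  rw [hH.sum_sq_vecMul]
  field_simp

/-! ### Group privacy -/

/-- Replace the differing data points one at a time; each replacement multiplies the accumulated
bound by `exp ε` and adds `δ`. -/
theorem IsDifferentiallyPrivate.le_of_hammingDist_le {U R : Type*} [DecidableEq U]
    [MeasurableSpace R] {n : ℕ} {law : (Fin n → U) → Measure R} {ε δ : ℝ}
    (h : IsDifferentiallyPrivate law ε δ) (hε : 0 ≤ ε) (hδ : 0 ≤ δ) {S : Set R}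
    (hS : MeasurableSet S) (k : ℕ) :
    ∀ x x' : Fin n → U, hammingDist x x' ≤ k →
      (law x).real S ≤
        Real.exp ε ^ k * (law x').real S + δ * ∑ i ∈ Finset.range k, Real.exp ε ^ i := by
  induction k with
  | zero =>
    intro x x' hx
    have : x = x' := by simpa using hx
    simp [this]
  | succ k ih =>
    intro x x' hx
    have h1 : 1 ≤ Real.exp ε := Real.one_le_exp hε
    -- Neighbours differ in exactly one point, so equal datasets need a separate argument.
    by_cases hne : x = x'
    · subst hne
      have h2 : (law x).real S ≤ Real.exp ε ^ (k + 1) * (law x).real S :=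
        le_mul_of_one_le_left measureReal_nonneg (one_le_pow₀ h1)
      have h3 : 0 ≤ δ * ∑ i ∈ Finset.range (k + 1), Real.exp ε ^ i := by positivity
      linarith
    · obtain ⟨i, hi⟩ := Function.ne_iff.1 hne
      set y := Function.update x i (x' i) with hy
      have hxy : Neighboring x y := by
        refine ⟨i, by simpa [hy] using hi, fun j hj => ?_⟩
        by_contra hji
        exact hj (by simp [hy, Function.update_of_ne hji])
      have hlt : hammingDist y x' < hammingDist x x' := by
        refine Finset.card_lt_card ?_
        rw [Finset.ssubset_iff_of_subset]
        · exact ⟨i, by simpa using hi, by simp [hy]⟩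
        · intro j hj
          simp only [Finset.mem_filter, Finset.mem_univ, true_and] at hj ⊢
          by_cases hji : j = i
          · subst hji; simp [hy] at hj
          · simpa [hy, Function.update_of_ne hji] using hj
      have hxy' := h x y hxy S hS
      have hyx := ih y x' (by omega)
      calc (law x).real S ≤ Real.exp ε * (law y).real S + δ := hxy'
        _ ≤ Real.exp ε * (Real.exp ε ^ k * (law x').real S +
              δ * ∑ i ∈ Finset.range k, Real.exp ε ^ i) + δ := by gcongr
        _ = _ := by
          rw [Finset.sum_range_succ', pow_succ]
          simp only [pow_succ, ← Finset.sum_mul]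
          ring

/-! ### Averaging -/

/-- A set of probability `p` on which at least `r` of the events `E i` hold forces the
probabilities of these events to add up to at least `p r`. -/
theorem mul_le_sum_measureReal {R I : Type*} [MeasurableSpace R] [Fintype I] (μ : Measure R)
    [IsProbabilityMeasure μ] {G : Set R} (hG : MeasurableSet G) {E : I → Set R}
    (hE : ∀ i, MeasurableSet (E i)) {r : ℝ}
    (h : ∀ y ∈ G, r ≤ ∑ i, (E i).indicator (fun _ => (1 : ℝ)) y) :
    μ.real G * r ≤ ∑ i, μ.real (E i) := by
  have hint : ∀ i, Integrable ((E i).indicator fun _ => (1 : ℝ)) μ :=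
    fun i => (integrable_const 1).indicator (hE i)
  calc μ.real G * r = ∫ y, G.indicator (fun _ => r) y ∂μ := by
        rw [integral_indicator_const r hG, smul_eq_mul]
    _ ≤ ∫ y, ∑ i, (E i).indicator (fun _ => (1 : ℝ)) y ∂μ := by
        refine integral_mono ((integrable_const r).indicator hG)
          (integrable_finsetSum _ fun i _ => hint i) fun y => ?_
        by_cases hy : y ∈ G
        · simpa [hy] using h y hy
        · simp only [hy, not_false_eq_true, Set.indicator_of_notMem]
          exact Finset.sum_nonneg fun i _ => Set.indicator_nonneg (fun _ _ => zero_le_one) _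
    _ = ∑ i, μ.real (E i) := by
        rw [integral_finsetSum _ fun i _ => hint i]
        refine Finset.sum_congr rfl fun i _ => ?_
        rw [integral_indicator_const _ (hE i), smul_eq_mul, mul_one]

/-- If the coordinatewise scores `f i b` add up to at least `r` for every word `b`, then along some
line of words, in direction `i`, the average score is at least `r / |I|`. -/
theorem exists_mul_card_le_sum_update {I A : Type*} [Fintype I] [DecidableEq I] [Fintype A]
    [Nonempty A] [Nonempty I] (f : I → (I → A) → ℝ) {r : ℝ} (h : ∀ b, r ≤ ∑ i, f i b) :
    ∃ i b, r * Fintype.card A ≤ Fintype.card I * ∑ a, f i (Function.update b i a) := by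
  by_contra! hlt
  have hline : ∀ i, ∑ b : I → A, ∑ a, f i (Function.update b i a) =
      Fintype.card A * ∑ b, f i b := by
    intro i
    calc ∑ b : I → A, ∑ a, f i (Function.update b i a)
        = ∑ p : (I → A) × A, f i (Function.update p.1 i p.2) := by
          rw [Fintype.sum_prod_type]
      _ = ∑ p : (I → A) × A, f i p.1 := by
          -- Exchanging the `i`-th letter of the word with the extra letter is an involution.
          refine Fintype.sum_bijective (fun p => (Function.update p.1 i p.2, p.1 i)) ?_ _ _
            fun p => rfl
          refine Function.Involutive.bijective fun p => ?_
          simp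
      _ = Fintype.card A * ∑ b, f i b := by
          rw [Fintype.sum_prod_type]
          simp [Finset.mul_sum]
  have h1 : ∑ i : I, ∑ b : I → A, (Fintype.card I * ∑ a, f i (Function.update b i a)) <
      ∑ i : I, ∑ b : I → A, r * Fintype.card A :=
    Finset.sum_lt_sum_of_nonempty Finset.univ_nonempty fun i _ =>
      Finset.sum_lt_sum_of_nonempty Finset.univ_nonempty fun b _ => hlt i b
  have h2 : ∑ b : I → A, r ≤ ∑ b : I → A, ∑ i, f i b := Finset.sum_le_sum fun b _ => h b
  rw [Finset.sum_comm] at h2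
  simp only [← Finset.mul_sum, hline] at h1
  simp only [Finset.sum_const, Finset.card_univ, nsmul_eq_mul] at h1 h2
  have h3 : (0 : ℝ) < Fintype.card I * Fintype.card A := by positivity
  nlinarith [mul_le_mul_of_nonneg_left h2 h3.le]

/-! ### The queries -/

theorem Matrix.IsHadamard.abs_apply {m : Type*} [Fintype m] [DecidableEq m] {H : Matrix m m ℝ}
    (hH : H.IsHadamard) (i j : m) : |H i j| = 1 :=
  (abs_eq zero_le_one).2 (sq_eq_one_iff.1 (hH.sq_apply i j))

/-- The rows of `H`, scaled geometrically by powers of `√2`, as queries on `Fin N`: they vanish on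
points beyond the columns of `H`, and there are null queries beyond the rows of `H`. -/
def scaledRowQueries (N : ℕ) {m : ℕ} (H : Matrix (Fin m) (Fin m) ℝ) (t u : Fin N) : ℝ :=
  if h : t.1 < m ∧ u.1 < m then Real.sqrt 2 ^ (t : ℕ) * H ⟨t, h.1⟩ ⟨u, h.2⟩ else 0

section scaledRowQueries

variable {N m : ℕ} {H : Matrix (Fin m) (Fin m) ℝ}

theorem scaledRowQueries_castLE (hm : m ≤ N) (t u : Fin m) :
    scaledRowQueries N H (Fin.castLE hm t) (Fin.castLE hm u) = Real.sqrt 2 ^ (t : ℕ) * H t u := by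
  simp [scaledRowQueries]

theorem sqrt_two_pow_sq (t : ℕ) : (Real.sqrt 2 ^ t) ^ 2 = 2 ^ t := by
  rw [← pow_mul, mul_comm, pow_mul, Real.sq_sqrt zero_le_two]

theorem scaledRowQueries_sq_le (hH : H.IsHadamard) (t u : Fin N) :
    scaledRowQueries N H t u ^ 2 ≤ if t.1 < m then 2 ^ (t : ℕ) else 0 := by
  unfold scaledRowQueries
  split_ifs with h h' h'
  · rw [mul_pow, hH.sq_apply, mul_one, sqrt_two_pow_sq]
  · exact absurd h.1 h'
  · rw [zero_pow two_ne_zero]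
    positivity
  · simp

/-- The geometric column sum is dominated by its last term, so the allowed error at time `t` exceeds
the scale of the row `t` only by a constant factor. -/
theorem gammaTwo_queryPrefix_le (hH : H.IsHadamard) (t : Fin N) :
    gammaTwo (queryPrefix (scaledRowQueries N H) t) ≤ Real.sqrt 2 ^ ((t : ℕ) + 1) := by
  refine gammaTwo_le _ (by positivity) fun u => ?_
  rw [sqrt_two_pow_sq]
  calc ∑ i : {i : Fin N // i ≤ t}, scaledRowQueries N H i.1 u ^ 2
      ≤ ∑ i : {i : Fin N // i ≤ t}, (2 : ℝ) ^ (i.1 : ℕ) := by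
        refine Finset.sum_le_sum fun i _ => (scaledRowQueries_sq_le hH i.1 u).trans ?_
        split_ifs
        · exact le_rfl
        · positivity
    _ = ∑ i ∈ Finset.univ.image fun i : {i : Fin N // i ≤ t} => (i.1 : ℕ), (2 : ℝ) ^ i := by
        rw [Finset.sum_image]
        intro i _ j _ hij
        exact Subtype.ext (Fin.ext hij)
    _ ≤ ∑ i ∈ Finset.range (t + 1), (2 : ℝ) ^ i := by
        refine Finset.sum_le_sum_of_subset_of_nonneg ?_ fun _ _ _ => by positivity
        intro i hi
        obtain ⟨j, -, rfl⟩ := Finset.mem_image.1 hi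
        exact Finset.mem_range.2 (Nat.lt_succ_of_le j.2)
    _ ≤ 2 ^ ((t : ℕ) + 1) := by
        rw [geom_sum_eq (by norm_num)]
        norm_num

/-- A crude bound, chosen because its logarithm `m - 1` vanishes at `m = 1`; this covers `N = 1`
without an exception. -/
theorem gammaTwo_queryMatrix_le (hH : H.IsHadamard) (hm : 0 < m) :
    gammaTwo (queryMatrix (scaledRowQueries N H)) ≤ 2 ^ (m - 1) := by
  refine gammaTwo_le _ (by positivity) fun u => ?_
  calc ∑ i, scaledRowQueries N H i u ^ 2
      ≤ ∑ i : Fin N, if i.1 < m then (2 : ℝ) ^ (i : ℕ) else 0 :=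
        Finset.sum_le_sum fun i _ => scaledRowQueries_sq_le hH i u
    _ = ∑ i ∈ Finset.range N, if i < m then (2 : ℝ) ^ i else 0 :=
        Fin.sum_univ_eq_sum_range (fun i => if i < m then (2 : ℝ) ^ i else 0) N
    _ ≤ ∑ i ∈ Finset.range m, (2 : ℝ) ^ i := by
        rw [← Finset.sum_filter]
        refine Finset.sum_le_sum_of_subset_of_nonneg ?_ fun _ _ _ => by positivity
        intro i hi
        simpa using (Finset.mem_filter.1 hi).2
    _ ≤ (2 ^ (m - 1)) ^ 2 := by
        obtain ⟨k, rfl⟩ : ∃ k, m = k + 1 := ⟨m - 1, by omega⟩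
        rw [geom_sum_eq (by norm_num), pow_succ, Nat.add_sub_cancel]
        -- `2 ^ (k + 1) - 1 ≤ 4 ^ k` is the expansion of `(2 ^ k - 1) ^ 2 ≥ 0`.
        nlinarith [sq_nonneg ((2 : ℝ) ^ k - 1)]

theorem sqrt_two_pow_le_gammaTwo (hH : H.IsHadamard) (hm : m ≤ N) (hm0 : 0 < m) :
    Real.sqrt 2 ^ (m - 1) ≤ gammaTwo (queryMatrix (scaledRowQueries N H)) := by
  let t : Fin m := ⟨m - 1, by omega⟩
  refine le_trans (le_of_eq ?_)
    (abs_apply_le_gammaTwo (queryMatrix (scaledRowQueries N H)) (Fin.castLE hm t) (Fin.castLE hm t))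
  rw [queryMatrix, Matrix.of_apply, scaledRowQueries_castLE, abs_mul, hH.abs_apply, mul_one,
    abs_of_nonneg (by positivity)]

theorem gammaTwo_queryPrefix_pos (hH : H.IsHadamard) (hm : m ≤ N) (t : Fin m) :
    0 < gammaTwo (queryPrefix (scaledRowQueries N H) (Fin.castLE hm t)) := by
  refine lt_of_lt_of_le ?_ (abs_apply_le_gammaTwo
    (queryPrefix (scaledRowQueries N H) (Fin.castLE hm t)) ⟨_, le_rfl⟩ (Fin.castLE hm t))
  rw [queryPrefix, Matrix.submatrix_apply, queryMatrix, Matrix.of_apply, id,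
    scaledRowQueries_castLE, abs_mul, hH.abs_apply]
  positivity

theorem norm_scaledRowQueries_zero (hH : H.IsHadamard) (hm : m ≤ N) (hm0 : 0 < m) :
    ‖scaledRowQueries N H ⟨0, hm0.trans_le hm⟩‖ = 1 := by
  refine le_antisymm ((pi_norm_le_iff_of_nonneg zero_le_one).2 fun u => ?_) ?_
  · have := scaledRowQueries_sq_le hH ⟨0, hm0.trans_le hm⟩ u
    rw [if_pos hm0, pow_zero] at this
    exact abs_le_one_iff_mul_self_le_one.2 (by rwa [← sq])
  · refine le_trans (le_of_eq ?_) (norm_le_pi_norm _ (Fin.castLE hm ⟨0, hm0⟩))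
    have := scaledRowQueries_castLE (H := H) hm ⟨0, hm0⟩ ⟨0, hm0⟩
    rw [Fin.castLE_mk] at this ⊢
    rw [this, norm_mul, Real.norm_eq_abs (H _ _), hH.abs_apply]
    simp

/-- On data points among the columns of `H`, a query reads off the corresponding Hadamard
coefficient of the histogram of the dataset. -/
theorem queryAnswer_scaledRowQueries (hm : m ≤ N) {n : ℕ} (x : Fin n → Fin m) (t : Fin m) :
    queryAnswer (scaledRowQueries N H (Fin.castLE hm t)) (Fin.castLE hm ∘ x) =
      Real.sqrt 2 ^ (t : ℕ) * (∑ v, H t v * (Finset.univ.filter fun l => x l = v).card) / n := by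
  have h : ∑ l, H t (x l) = ∑ v, H t v * (Finset.univ.filter fun l => x l = v).card := by
    rw [← Finset.sum_fiberwise Finset.univ x]
    refine Finset.sum_congr rfl fun v _ => ?_
    rw [Finset.sum_congr rfl fun l hl => by rw [(Finset.mem_filter.1 hl).2], Finset.sum_const,
      nsmul_eq_mul, mul_comm]
  simp only [queryAnswer, Function.comp_apply, scaledRowQueries_castLE, ← Finset.mul_sum, h]

end scaledRowQueries

/-! ### Planted datasets -/

section planted

variable {I A J S U : Type*} {n : ℕ}

/-- The dataset that encodes the word `b`: the slot `s` of block `i` holds the point of block `i`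
selected by `g (b i) s`, if any; all other data points are equal to `dummy`. -/
def plantedDataset (pos : I × S ↪ Fin n) (g : A → S → Option J) (e : I × J → U) (dummy : U)
    (b : I → A) : Fin n → U :=
  Function.extend pos (fun p => (g (b p.1) p.2).elim dummy fun j => e (p.1, j)) fun _ => dummy

variable (pos : I × S ↪ Fin n) (g : A → S → Option J) (e : I × J → U) (dummy : U)

theorem plantedDataset_pos (b : I → A) (p : I × S) :
    plantedDataset pos g e dummy b (pos p) = (g (b p.1) p.2).elim dummy fun j => e (p.1, j) :=
  pos.injective.extend_apply _ _ p

theorem plantedDataset_of_notMem (b : I → A) {l : Fin n} (hl : ¬ ∃ p, pos p = l) :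
    plantedDataset pos g e dummy b l = dummy :=
  Function.extend_apply' _ _ _ hl

/-- Blocks occupy disjoint sets of points, none of them `dummy`, so the counts in block `i` depend
on the letter `b i` alone. -/
theorem card_plantedDataset_eq [DecidableEq J] [Fintype S] [DecidableEq U]
    (he : Function.Injective e) (hdummy : ∀ p, e p ≠ dummy) (b : I → A) (i : I) (j : J) :
    (Finset.univ.filter fun l => plantedDataset pos g e dummy b l = e (i, j)).card =
      (Finset.univ.filter fun s => g (b i) s = some j).card := by
  symm
  refine Finset.card_bij (fun s _ => pos (i, s)) (fun s hs => ?_) (fun s _ s' _ hss => ?_)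
    fun l hl => ?_
  · rw [Finset.mem_filter] at hs ⊢
    refine ⟨Finset.mem_univ _, ?_⟩
    rw [plantedDataset_pos, hs.2]
    rfl
  · exact (Prod.ext_iff.1 (pos.injective hss)).2
  · rw [Finset.mem_filter] at hl
    by_cases hp : ∃ p, pos p = l
    · obtain ⟨⟨i', s⟩, rfl⟩ := hp
      have h := hl.2
      rw [plantedDataset_pos] at h
      cases hg : g (b i') s with
      | none => rw [hg] at h; exact absurd h.symm (hdummy _)
      | some j' =>
        rw [hg] at h
        obtain ⟨rfl, rfl⟩ := Prod.ext_iff.1 (he h)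
        exact ⟨s, by simpa using hg, rfl⟩
    · rw [plantedDataset_of_notMem pos g e dummy b hp] at hl
      exact absurd hl.2.symm (hdummy _)

theorem hammingDist_plantedDataset_update_le [DecidableEq I] [DecidableEq J] [Fintype S]
    [DecidableEq U] (b : I → A) (i : I) (a a' : A) :
    hammingDist (plantedDataset pos g e dummy (Function.update b i a))
      (plantedDataset pos g e dummy (Function.update b i a')) ≤
        (Finset.univ.filter fun s => g a s ≠ g a' s).card := by
  classical
  refine (Finset.card_le_card (t := (Finset.univ.filter fun s => g a s ≠ g a' s).image
    fun s => pos (i, s)) fun l hl => ?_).trans Finset.card_image_le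
  rw [Finset.mem_filter] at hl
  by_cases hp : ∃ p, pos p = l
  · obtain ⟨⟨i', s⟩, rfl⟩ := hp
    rw [plantedDataset_pos, plantedDataset_pos] at hl
    by_cases hi : i' = i
    · subst hi
      refine Finset.mem_image.2 ⟨s, Finset.mem_filter.2 ⟨Finset.mem_univ _, fun h => ?_⟩, rfl⟩
      exact hl.2 (by simp [h])
    · exact absurd (by simp [Function.update_of_ne hi]) hl.2
  · rw [plantedDataset_of_notMem _ _ _ _ _ hp, plantedDataset_of_notMem _ _ _ _ _ hp] at hl
    exact absurd rfl hl.2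

end planted

/-! ### Reconstruction -/

/-- The histogram estimated from the answers `y` to the queries `scaledRowQueries N H` by
inverting `H`. -/
def reconstruct {N m : ℕ} (H : Matrix (Fin m) (Fin m) ℝ) (hm : m ≤ N) (n : ℕ) (y : Fin N → ℝ)
    (u : Fin m) : ℝ :=
  (∑ t, H t u * (n * y (Fin.castLE hm t) / Real.sqrt 2 ^ (t : ℕ))) / m

theorem measurable_reconstruct {N m : ℕ} (H : Matrix (Fin m) (Fin m) ℝ) (hm : m ≤ N) (n : ℕ)
    (u : Fin m) : Measurable fun y => reconstruct H hm n y u := by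
  unfold reconstruct
  fun_prop

/-- After multiplication by `n / √2 ^ t` the allowed error is at most `√2 C / ε` for every `t`;
inverting `H` then keeps the total error free of `m`. -/
theorem sum_sq_reconstruct_sub_card_le {N m n : ℕ} {H : Matrix (Fin m) (Fin m) ℝ}
    (hH : H.IsHadamard) (hm : m ≤ N) (hm0 : 0 < m) (hn : 0 < n) {ε C : ℝ} (hε : 0 < ε)
    (hC : 0 ≤ C) (x : Fin n → Fin m) {y : Fin N → ℝ}
    (hy : ∀ t, |queryAnswer (scaledRowQueries N H t) (Fin.castLE hm ∘ x) - y t| ≤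
      C * gammaTwo (queryPrefix (scaledRowQueries N H) t) / (ε * n)) :
    ∑ u, (reconstruct H hm n y u - (Finset.univ.filter fun l => x l = u).card) ^ 2 ≤
      2 * C ^ 2 / ε ^ 2 := by
  have : Nonempty (Fin m) := ⟨⟨0, hm0⟩⟩
  have hn' : (0 : ℝ) < n := Nat.cast_pos.2 hn
  have hm' : (0 : ℝ) < m := Nat.cast_pos.2 hm0
  have key := hH.sum_sq_reconstruct_sub
    (fun u => ((Finset.univ.filter fun l => x l = u).card : ℝ))
    (fun t => n * y (Fin.castLE hm t) / Real.sqrt 2 ^ (t : ℕ))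
  rw [Fintype.card_fin] at key
  unfold reconstruct
  rw [key, div_le_iff₀ hm']
  have hterm : ∀ t : Fin m, (n * y (Fin.castLE hm t) / Real.sqrt 2 ^ (t : ℕ) -
      ∑ v, H t v * ((Finset.univ.filter fun l => x l = v).card : ℝ)) ^ 2 ≤
        2 * C ^ 2 / ε ^ 2 := by
    intro t
    have h := hy (Fin.castLE hm t)
    rw [queryAnswer_scaledRowQueries] at h
    set s := ∑ v, H t v * ((Finset.univ.filter fun l => x l = v).card : ℝ)
    set r := Real.sqrt 2 ^ (t : ℕ) with hr
    have hr0 : 0 < r := by positivity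
    have hγ := gammaTwo_queryPrefix_le hH (Fin.castLE hm t)
    rw [Fin.val_castLE, pow_succ, ← hr] at hγ
    have h2 : |r * s / n - y (Fin.castLE hm t)| ≤ C * (r * Real.sqrt 2) / (ε * n) :=
      h.trans (by gcongr)
    have h3 : n * y (Fin.castLE hm t) / r - s =
        -(n / r * (r * s / n - y (Fin.castLE hm t))) := by
      field_simp
      ring
    have h4 : |n * y (Fin.castLE hm t) / r - s| ≤ C * Real.sqrt 2 / ε := by
      rw [h3, abs_neg, abs_mul, abs_of_pos (by positivity)]
      calc n / r * |r * s / n - y (Fin.castLE hm t)|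
          ≤ n / r * (C * (r * Real.sqrt 2) / (ε * n)) := by gcongr
        _ = C * Real.sqrt 2 / ε := by field_simp
    calc (n * y (Fin.castLE hm t) / r - s) ^ 2 = |n * y (Fin.castLE hm t) / r - s| ^ 2 :=
          (sq_abs _).symm
      _ ≤ (C * Real.sqrt 2 / ε) ^ 2 := by gcongr
      _ = 2 * C ^ 2 / ε ^ 2 := by
        rw [div_pow, mul_pow, Real.sq_sqrt zero_le_two]
        ring
  calc _ ≤ ∑ _t : Fin m, 2 * C ^ 2 / ε ^ 2 := Finset.sum_le_sum fun t _ => hterm t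
    _ = 2 * C ^ 2 / ε ^ 2 * m := by simp [mul_comm]

/-- The attack on a private and accurate algorithm: a random word over the alphabet `A` is planted
in the dataset and decoded letter by letter from the reconstructed histogram. For some position and
some choice of the other letters, the letters `a` are decoded correctly, through disjoint
events `E a`, with average probability almost `2 / 3`. -/
theorem exists_decoding_events {N m n : ℕ} {H : Matrix (Fin m) (Fin m) ℝ}
    (hH : H.IsHadamard) (hm : m ≤ N) (hn : 0 < n) {ε δ C : ℝ} (hε : 0 < ε)
    (hδ : 0 ≤ δ) (hC : 0 ≤ C) {law : (Fin n → Fin N) → Measure (Fin N → ℝ)}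
    [∀ x, IsProbabilityMeasure (law x)] (hlaw : IsDifferentiallyPrivate law ε δ)
    (hacc : ∀ x, 2 / 3 ≤ (law x).real {y | ∀ t, |queryAnswer (scaledRowQueries N H t) x - y t| ≤
      C * gammaTwo (queryPrefix (scaledRowQueries N H) t) / (ε * n)})
    {I A J S : Type*} [Fintype I] [Nonempty I] [Fintype A] [Nonempty A] [Fintype J]
    [DecidableEq J] [Fintype S] (pos : I × S ↪ Fin n) (g : A → S → Option J) (e : I × J → Fin m)
    (he : Function.Injective e) (dummy : Fin m) (hdummy : ∀ p, e p ≠ dummy) {D : ℝ} (hD : 0 < D)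
    (hsep : ∀ a a', a ≠ a' → D ≤ ∑ j, (((Finset.univ.filter fun s => g a s = some j).card : ℝ) -
      (Finset.univ.filter fun s => g a' s = some j).card) ^ 2) :
    ∃ (μ : A → Measure (Fin N → ℝ)) (E : A → Set (Fin N → ℝ)),
      (∀ a, IsProbabilityMeasure (μ a)) ∧ (∀ a, MeasurableSet (E a)) ∧
      (∀ a a', a ≠ a' → Disjoint (E a) (E a')) ∧
      (∀ k a a', (Finset.univ.filter fun s => g a s ≠ g a' s).card ≤ k →
        (μ a).real (E a) ≤ Real.exp ε ^ k * (μ a').real (E a) +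
          δ * ∑ i ∈ Finset.range k, Real.exp ε ^ i) ∧
      2 / 3 * (Fintype.card I - 8 * C ^ 2 / (ε ^ 2 * D)) * Fintype.card A ≤
        Fintype.card I * ∑ a, (μ a).real (E a) := by
  classical
  set w : A → J → ℝ := fun a j => (Finset.univ.filter fun s => g a s = some j).card with hw
  set X : (I → A) → Fin n → Fin m := plantedDataset pos g e dummy with hX
  set F : I → A → (Fin N → ℝ) → ℝ :=
    fun i a y => ∑ j, (reconstruct H hm n y (e (i, j)) - w a j) ^ 2 with hF
  have hFm : ∀ i a, Measurable (F i a) := fun i a =>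
    Finset.measurable_sum _ fun j _ =>
      ((measurable_reconstruct H hm n _).sub_const _).pow_const 2
  -- The radius `D / 4` makes the events disjoint: `(u - v)² ≤ 2 u² + 2 v²`, and two letters are at
  -- squared distance at least `D`.
  set E : I → A → Set (Fin N → ℝ) := fun i a => {y | F i a y < D / 4} with hE
  have hEm : ∀ i a, MeasurableSet (E i a) := fun i a =>
    measurableSet_lt (hFm i a) measurable_const
  have hdisj : ∀ i a a', a ≠ a' → Disjoint (E i a) (E i a') := by
    intro i a a' haa
    refine Set.disjoint_left.2 fun y hy hy' => ?_
    have hy1 : F i a y < D / 4 := hy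
    have hy2 : F i a' y < D / 4 := hy'
    have h1 : ∑ j, (w a j - w a' j) ^ 2 ≤ 2 * F i a y + 2 * F i a' y := by
      simp only [hF, Finset.mul_sum, ← Finset.sum_add_distrib]
      refine Finset.sum_le_sum fun j _ => ?_
      nlinarith [sq_nonneg ((reconstruct H hm n y (e (i, j)) - w a j) +
        (reconstruct H hm n y (e (i, j)) - w a' j))]
    linarith [hsep a a' haa]
  have hscore : ∀ b : I → A, 2 / 3 * (Fintype.card I - 8 * C ^ 2 / (ε ^ 2 * D)) ≤
      ∑ i, (law (Fin.castLE hm ∘ X b)).real (E i (b i)) := by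
    intro b
    set r := Fintype.card I - 8 * C ^ 2 / (ε ^ 2 * D) with hr
    have hsum : 0 ≤ ∑ i, (law (Fin.castLE hm ∘ X b)).real (E i (b i)) :=
      Finset.sum_nonneg fun i _ => measureReal_nonneg
    rcases le_total r 0 with hr0 | hr0
    · linarith
    refine (mul_le_mul_of_nonneg_right (hacc (Fin.castLE hm ∘ X b)) hr0).trans ?_
    refine mul_le_sum_measureReal _ ?_ (fun i => hEm i (b i)) fun y hy => ?_
    · rw [Set.ofPred_forall]
      refine MeasurableSet.iInter fun t => measurableSet_le ?_ measurable_const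
      fun_prop
    · have herr := sum_sq_reconstruct_sub_card_le hH hm (Fin.pos dummy) hn hε hC (X b) hy
      have hblocks : ∑ i, F i (b i) y ≤ 2 * C ^ 2 / ε ^ 2 := by
        refine le_trans ?_ herr
        simp only [hF]
        rw [← Fintype.sum_prod_type' (fun i j =>
          (reconstruct H hm n y (e (i, j)) - w (b i) j) ^ 2)]
        calc ∑ p : I × J, (reconstruct H hm n y (e (p.1, p.2)) - w (b p.1) p.2) ^ 2
            = ∑ p : I × J, (reconstruct H hm n y (e p) -
                (Finset.univ.filter fun l => X b l = e p).card) ^ 2 := by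
              refine Finset.sum_congr rfl fun p _ => ?_
              rw [hX, card_plantedDataset_eq pos g e dummy he hdummy b p.1 p.2]
          _ = ∑ u ∈ Finset.univ.image e, (reconstruct H hm n y u -
                (Finset.univ.filter fun l => X b l = u).card) ^ 2 := by
              rw [Finset.sum_image fun p _ p' _ h => he h]
          _ ≤ _ := Finset.sum_le_sum_of_subset_of_nonneg (Finset.subset_univ _)
              fun _ _ _ => sq_nonneg _
      -- Markov's inequality in pointwise form: a block that is not decoded uses up at least `D / 4`
      -- of the total error.
      have hind : ∀ i, 1 - 4 / D * F i (b i) y ≤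
          (E i (b i)).indicator (fun _ => (1 : ℝ)) y := by
        intro i
        have hF0 : 0 ≤ F i (b i) y := Finset.sum_nonneg fun j _ => sq_nonneg _
        by_cases hyE : y ∈ E i (b i)
        · rw [Set.indicator_of_mem hyE]
          have : 0 ≤ 4 / D * F i (b i) y := by positivity
          linarith
        · rw [Set.indicator_of_notMem hyE]
          have h1 : D / 4 ≤ F i (b i) y := not_lt.1 hyE
          have h2 : 4 / D * (D / 4) ≤ 4 / D * F i (b i) y := by gcongr
          have h3 : 4 / D * (D / 4) = 1 := by field_simp
          linarith
      calc r ≤ Fintype.card I - 4 / D * ∑ i, F i (b i) y := by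
            have h1 : 4 / D * ∑ i, F i (b i) y ≤ 4 / D * (2 * C ^ 2 / ε ^ 2) := by gcongr
            have h2 : 4 / D * (2 * C ^ 2 / ε ^ 2) = 8 * C ^ 2 / (ε ^ 2 * D) := by
              field_simp
              ring
            rw [hr]
            linarith
        _ = ∑ i, (1 - 4 / D * F i (b i) y) := by
            simp [Finset.sum_sub_distrib, Finset.mul_sum]
        _ ≤ _ := Finset.sum_le_sum fun i _ => hind i
  obtain ⟨i, b, hib⟩ := exists_mul_card_le_sum_update
    (fun i b => (law (Fin.castLE hm ∘ X b)).real (E i (b i))) hscore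
  refine ⟨fun a => law (Fin.castLE hm ∘ X (Function.update b i a)), E i, fun a => inferInstance,
    hEm i, hdisj i, fun k a a' hk => ?_, by simpa using hib⟩
  refine hlaw.le_of_hammingDist_le hε.le hδ (hEm i a) k _ _ (le_trans ?_ hk)
  exact (hammingDist_comp_le_hammingDist (fun _ => Fin.castLE hm)).trans
    (hammingDist_plantedDataset_update_le pos g e dummy b i a a')

/-! ### The error factor -/

theorem sum_measureReal_le_one {R A : Type*} [MeasurableSpace R] [Fintype A] (μ : Measure R)
    [IsProbabilityMeasure μ] {E : A → Set R} (hE : ∀ a, MeasurableSet (E a))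
    (hdisj : ∀ a a', a ≠ a' → Disjoint (E a) (E a')) : ∑ a, μ.real (E a) ≤ 1 := by
  rw [← measureReal_biUnion_finset (fun a _ a' _ h => hdisj a a' h) fun a _ => hE a]
  exact measureReal_le_one

section errorFactor

variable {N m : ℕ} {H : Matrix (Fin (m + 1)) (Fin (m + 1)) ℝ}

theorem logb_gammaTwo_le (hH : H.IsHadamard) (hm : m + 1 ≤ N) :
    Real.logb 2 (gammaTwo (queryMatrix (scaledRowQueries N H))) ≤ m := by
  have h0 := sqrt_two_pow_le_gammaTwo hH hm m.succ_pos
  have h1 := gammaTwo_queryMatrix_le (N := N) hH m.succ_pos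
  rw [Nat.add_sub_cancel] at h0 h1
  rw [Real.logb_le_iff_le_rpow one_lt_two (lt_of_lt_of_le (by positivity) h0), Real.rpow_natCast]
  exact h1

theorem half_le_logb_gammaTwo (hH : H.IsHadamard) (hm : m + 1 ≤ N) :
    (m : ℝ) / 2 ≤ Real.logb 2 (gammaTwo (queryMatrix (scaledRowQueries N H))) := by
  have h0 := sqrt_two_pow_le_gammaTwo hH hm m.succ_pos
  rw [Nat.add_sub_cancel] at h0
  rw [Real.le_logb_iff_rpow_le one_lt_two (lt_of_lt_of_le (by positivity) h0)]
  refine le_trans (le_of_eq ?_) h0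
  rw [Real.sqrt_eq_rpow, ← Real.rpow_natCast, ← Real.rpow_mul zero_le_two]
  congr 1
  ring

/-- It suffices to bound the error factor of private output laws, and `log₂ γ₂(Q)` may be replaced
by the number of rows of the Hadamard matrix, minus one. -/
theorem errorFactorAtLeast_of_law (hH : H.IsHadamard) (hm : m + 1 ≤ N) {ε δ c : ℝ} (hε : 0 < ε)
    (hc : 0 ≤ c) (n₀ : ℕ)
    (h : ∀ n ≥ n₀, 0 < n → ∀ law : (Fin n → Fin N) → Measure (Fin N → ℝ),
      (∀ x, IsProbabilityMeasure (law x)) → IsDifferentiallyPrivate law ε δ → ∀ C : ℝ, 0 ≤ C →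
      (∀ x, 2 / 3 ≤ (law x).real {y | ∀ t, |queryAnswer (scaledRowQueries N H t) x - y t| ≤
        C * gammaTwo (queryPrefix (scaledRowQueries N H) t) / (ε * n)}) → c * Real.sqrt m ≤ C) :
    ErrorFactorAtLeast.{u} (scaledRowQueries N H) ε δ c := by
  refine ⟨n₀ + 1, fun n hn M hM C hacc => ?_⟩
  have hn0 : 0 < n := by omega
  have hn' : (0 : ℝ) < n := Nat.cast_pos.2 hn0
  have hmeas : ∀ x, Measurable (M.answers x (scaledRowQueries N H)) := fun x =>
    measurable_pi_lambda _ fun t => M.measurable_answer _ _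
  -- An event of probability at least `2 / 3` is nonempty, and a negative `C` would give a negative
  -- error bound because `γ₂(Q_t) > 0`.
  have hC : 0 ≤ C := by
    let t : Fin N := Fin.castLE hm 0
    let x : Fin n → Fin N := fun _ => t
    have hx := hacc x
    have hne : {ω | ∀ t, |queryAnswer (scaledRowQueries N H t) x -
        M.answers x (scaledRowQueries N H) ω t| ≤
          C * gammaTwo (queryPrefix (scaledRowQueries N H) t) / (ε * n)}.Nonempty := by
      by_contra hempty
      rw [Set.not_nonempty_iff_eq_empty] at hempty
      rw [hempty, measureReal_empty] at hx
      norm_num at hx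
    obtain ⟨ω, hω⟩ := hne
    have h0 := (abs_nonneg _).trans (hω t)
    have hγ := gammaTwo_queryPrefix_pos hH hm 0
    by_contra! hneg
    exact absurd h0 (not_le.2 (div_neg_of_neg_of_pos (mul_neg_of_neg_of_pos hneg hγ)
      (by positivity)))
  refine le_trans ?_ (h n (by omega) hn0 (M.transcriptLaw (scaledRowQueries N H))
    (fun x => Measure.isProbabilityMeasure_map (hmeas x).aemeasurable) (hM N _) C hC fun x => ?_)
  · gcongr
    exact logb_gammaTwo_le hH hm
  · rw [InteractiveAlgorithm.transcriptLaw, map_measureReal_apply (hmeas x)]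
    · exact hacc x
    · rw [Set.ofPred_forall]
      refine MeasurableSet.iInter fun t => measurableSet_le ?_ measurable_const
      fun_prop

/-- Unary encoding of the letters of `Fin (p + 1)` by `p` groups of `k` slots. -/
def unarySlots (p k : ℕ) (a : Fin (p + 1)) (s : Fin p × Fin k) : Option Unit :=
  if s.1.1 < a.1 then some () else none

theorem card_unarySlots_eq (p k : ℕ) (a : Fin (p + 1)) (j : Unit) :
    (Finset.univ.filter fun s => unarySlots p k a s = some j).card = a * k := by
  have h : (Finset.univ.filter fun s : Fin p × Fin k => unarySlots p k a s = some j) =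
      (Finset.univ.filter fun i : Fin p => i.1 < a.1) ×ˢ Finset.univ := by
    ext s
    simp [unarySlots]
  rw [h, Finset.card_product, Fin.card_filter_val_lt, Finset.card_fin,
    min_eq_right (Nat.lt_succ_iff.1 a.2)]

/-- Consecutive letters differ only on the slots of group `min a a'`. -/
theorem card_unarySlots_ne_le (p k : ℕ) {a a' : Fin (p + 1)}
    (h : a.1 + 1 = a'.1 ∨ a'.1 + 1 = a.1) :
    (Finset.univ.filter fun s => unarySlots p k a s ≠ unarySlots p k a' s).card ≤ k := by
  refine (Finset.card_le_card_of_injOn Prod.snd (t := Finset.univ) (fun _ _ => by simp)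
    fun s hs s' hs' hss => Prod.ext (Fin.ext ?_) hss).trans (Finset.card_fin k).le
  have key : ∀ s : Fin p × Fin k, unarySlots p k a s ≠ unarySlots p k a' s →
      s.1.1 = min a.1 a'.1 := by
    intro s hs
    unfold unarySlots at hs
    split_ifs at hs with h1 h2 h2
    · exact absurd rfl hs
    · omega
    · omega
    · exact absurd rfl hs
  rw [key s (by simpa using hs), key s' (by simpa using hs')]

/-- Six laws on a path, neighbouring ones being close: disjoint events `E a` cannot have average
probability close to `2 / 3` under the respective laws `μ a`. -/
theorem sum_measureReal_path_le {R : Type*} [MeasurableSpace R] (μ : Fin 6 → Measure R)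
    [∀ a, IsProbabilityMeasure (μ a)] {E : Fin 6 → Set R} (hE : ∀ a, MeasurableSet (E a))
    (hdisj : ∀ a a', a ≠ a' → Disjoint (E a) (E a'))
    (hpriv : ∀ a a' : Fin 6, a.1 + 1 = a'.1 ∨ a'.1 + 1 = a.1 →
      (μ a).real (E a) ≤ 2.7183 * (μ a').real (E a) + 0.0136) :
    ∑ a, (μ a).real (E a) ≤ 3.92 := by
  have hsum : ∀ a, ∑ a', (μ a).real (E a') ≤ 1 := fun a => sum_measureReal_le_one (μ a) hE hdisj
  have hnn : ∀ a a', 0 ≤ (μ a).real (E a') := fun a a' => measureReal_nonneg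
  simp only [Fin.sum_univ_six] at hsum ⊢
  have s0 := hsum 0
  have s1 := hsum 1
  have s2 := hsum 2
  have s3 := hsum 3
  have s4 := hsum 4
  have s5 := hsum 5
  have u01 := hpriv 0 1 (by decide)
  have u12 := hpriv 1 2 (by decide)
  have u23 := hpriv 2 3 (by decide)
  have u34 := hpriv 3 4 (by decide)
  have u45 := hpriv 4 5 (by decide)
  have d10 := hpriv 1 0 (by decide)
  have d21 := hpriv 2 1 (by decide)
  have d32 := hpriv 3 2 (by decide)
  have d43 := hpriv 4 3 (by decide)
  have d54 := hpriv 5 4 (by decide)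
  -- With `p a = (μ a).real (E a)`, the total mass under `μ a` gives `p a + (p (a - 1) + p (a + 1) -
  -- 0.0272) / 2.7183 ≤ 1` at interior letters, and similarly at the ends. Two letters would not do:
  -- there the average can reach `1 / (1 + 1 / e) > 2 / 3`.
  linarith [hnn 0 1, hnn 0 2, hnn 0 3, hnn 0 4, hnn 0 5, hnn 1 3, hnn 1 4, hnn 1 5, hnn 2 0,
    hnn 2 4, hnn 2 5, hnn 3 0, hnn 3 1, hnn 3 5, hnn 4 0, hnn 4 1, hnn 4 2, hnn 5 0, hnn 5 1,
    hnn 5 2, hnn 5 3, hnn 5 4]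

theorem errorFactorAtLeast_of_le_one (hH : H.IsHadamard) (hm : m + 1 ≤ N) {ε δ : ℝ} (hε : 0 < ε)
    (hε1 : ε ≤ 1) (hδ : 0 ≤ δ) (hδε : δ ≤ 1 / 200 * ε) :
    ErrorFactorAtLeast.{u} (scaledRowQueries N H) ε δ (1 / 100) := by
  -- The largest group size with `k ε ≤ 1`, so that group privacy costs at most a factor `e`; still
  -- `k ε ≥ 1 / 2`, so letters are of order `1 / ε` apart.
  set k := ⌊1 / ε⌋₊ with hk
  have hkε : k * ε ≤ 1 := (le_div_iff₀ hε).1 (Nat.floor_le (by positivity))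
  have hk1 : 1 ≤ k := (Nat.one_le_floor_iff _).2 (by rwa [le_div_iff₀ hε, one_mul])
  have hk1' : (1 : ℝ) ≤ k := by exact_mod_cast hk1
  have hk2 : 1 ≤ 2 * (k * ε) := by
    have : 1 / ε < k + 1 := Nat.lt_floor_add_one _
    rw [div_lt_iff₀ hε] at this
    nlinarith
  have hexp : ∀ i ≤ k, Real.exp ε ^ i ≤ 2.7183 := by
    intro i hi
    rw [← Real.exp_nat_mul]
    have hi' : (i : ℝ) ≤ k := by exact_mod_cast hi
    calc Real.exp (i * ε) ≤ Real.exp 1 :=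
          Real.exp_le_exp.2 ((mul_le_mul_of_nonneg_right hi' hε.le).trans hkε)
      _ ≤ 2.7183 := Real.exp_one_lt_d9.le.trans (by norm_num)
  have hgroup : δ * ∑ i ∈ Finset.range k, Real.exp ε ^ i ≤ 0.0136 := by
    have h1 : ∑ i ∈ Finset.range k, Real.exp ε ^ i ≤ k * 2.7183 := by
      refine (Finset.sum_le_sum fun i hi => hexp i (Finset.mem_range.1 hi).le).trans ?_
      simp
    calc δ * ∑ i ∈ Finset.range k, Real.exp ε ^ i ≤ (1 / 200 * ε) * (k * 2.7183) := by gcongr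
      _ ≤ 0.0136 := by nlinarith
  refine errorFactorAtLeast_of_law hH hm hε (by norm_num) (m * (5 * k))
    fun n hn hn0 law hprob hlaw C hC hacc => ?_
  -- A Hadamard matrix of order one leaves no column besides the dummy one, but then the claim is `0
  -- ≤ C`.
  rcases Nat.eq_zero_or_pos m with rfl | hm0
  · simpa using hC
  have hm' : (0 : ℝ) < m := Nat.cast_pos.2 hm0
  have : Nonempty (Fin m) := ⟨⟨0, hm0⟩⟩
  obtain ⟨pos⟩ : Nonempty (Fin m × (Fin 5 × Fin k) ↪ Fin n) :=
    Function.Embedding.nonempty_of_card_le (by simpa using hn)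
  obtain ⟨μ, E, hμ, hE, hdisj, hpriv, hscore⟩ := exists_decoding_events hH hm hn0 hε hδ hC hlaw
    hacc pos (unarySlots 5 k) (fun p => p.1.succ)
    (fun p p' h => Prod.ext (Fin.succ_injective _ h) rfl) 0 (fun p => Fin.succ_ne_zero _)
    (D := (k : ℝ) ^ 2) (by positivity) fun a a' haa => by
      simp only [card_unarySlots_eq, Finset.univ_unique, Finset.sum_singleton, Nat.cast_mul]
      have h1 : (1 : ℝ) ≤ ((a : ℕ) - (a' : ℕ) : ℝ) ^ 2 := by
        have h2 : ((a : ℕ) : ℤ) - (a' : ℕ) ≠ 0 := by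
          rw [sub_ne_zero]
          exact_mod_cast fun h => haa (Fin.ext h)
        have h3 : (1 : ℤ) ≤ (((a : ℕ) : ℤ) - (a' : ℕ)) ^ 2 := Int.add_one_le_of_lt (sq_pos_iff.2 h2)
        exact_mod_cast h3
      calc (k : ℝ) ^ 2 ≤ ((a : ℕ) - (a' : ℕ) : ℝ) ^ 2 * (k : ℝ) ^ 2 :=
            le_mul_of_one_le_left (by positivity) h1
        _ = _ := by ring
  have hpath := sum_measureReal_path_le μ hE hdisj fun a a' haa =>
    (hpriv k a a' (card_unarySlots_ne_le 5 k haa)).trans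
      (add_le_add (mul_le_mul_of_nonneg_right (hexp k le_rfl) measureReal_nonneg) hgroup)
  by_contra! hlt
  have hC2 : C ^ 2 ≤ (m : ℝ) / 10000 := by
    calc C ^ 2 ≤ (1 / 100 * Real.sqrt m) ^ 2 := by gcongr
      _ = (m : ℝ) / 10000 := by
        rw [mul_pow, Real.sq_sqrt hm'.le]
        ring
  have herr : 8 * C ^ 2 / (ε ^ 2 * (k : ℝ) ^ 2) ≤ 32 * C ^ 2 := by
    rw [div_le_iff₀ (by positivity)]
    have h4 : 1 ≤ 4 * (ε ^ 2 * (k : ℝ) ^ 2) := by nlinarith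
    nlinarith [sq_nonneg C]
  simp only [Fintype.card_fin] at hscore
  -- This reads `4 m - 4 (8 C² / (ε² k²)) ≤ 3.92 m`, whereas the subtracted term is at most `128 C²
  -- ≤ 0.0128 m`.
  have hfin := hscore.trans (mul_le_mul_of_nonneg_left hpath hm'.le)
  push_cast at hfin
  linarith

/-- The error factor for privacy parameters `ε` and `δ < 2 / 3`, once there are more than `K` rows,
where `K` is large in terms of `ε` and `δ`. -/
theorem errorFactorAtLeast_of_le_card (hH : H.IsHadamard) (hm : m + 1 ≤ N) {ε δ : ℝ} (hε : 0 < ε)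
    (hδ : 0 ≤ δ) (hδ1 : δ < 2 / 3) {K : ℕ} (hK : 2 * Real.exp ε / (2 / 3 - δ) < K) (hKm : K ≤ m) :
    ErrorFactorAtLeast.{u} (scaledRowQueries N H) ε δ
      (ε * Real.sqrt ((2 / 3 - δ) / (32 * K))) := by
  set τ := 2 / 3 - δ with hτ
  have hτ0 : 0 < τ := by linarith
  have hK0' : (0 : ℝ) < K := lt_of_le_of_lt (by positivity) hK
  have hK0 : 0 < K := Nat.cast_pos.1 hK0'
  rw [div_lt_iff₀ hτ0] at hK
  set r := m / K with hr
  have hr0 : 0 < r := Nat.div_pos hKm hK0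
  have hrK : r * K ≤ m := Nat.div_mul_le_self m K
  -- Cutting `m` columns into `r` blocks of size `K` wastes at most half of them.
  have hmr : m ≤ 2 * (r * K) := by
    have h1 : m < r * K + K := Nat.lt_div_mul_add hK0
    have h2 : K ≤ r * K := Nat.le_mul_of_pos_left K hr0
    omega
  have hmr' : (m : ℝ) ≤ 2 * (r * K) := by exact_mod_cast hmr
  have hr0' : (0 : ℝ) < r := Nat.cast_pos.2 hr0
  have : Nonempty (Fin r) := ⟨⟨0, hr0⟩⟩
  have : Nonempty (Fin K) := ⟨⟨0, hK0⟩⟩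
  refine errorFactorAtLeast_of_law hH hm hε (by positivity) r
    fun n hn hn0 law hprob hlaw C hC hacc => ?_
  obtain ⟨pos⟩ : Nonempty (Fin r × Unit ↪ Fin n) :=
    Function.Embedding.nonempty_of_card_le (by simpa using hn)
  obtain ⟨μ, E, hμ, hE, hdisj, hpriv, hscore⟩ := exists_decoding_events hH hm hn0 hε hδ hC hlaw
    hacc pos (fun (a : Fin K) _ => some a)
    (fun p => (Fin.castLE hrK (finProdFinEquiv p)).succ)
    (fun p p' h => finProdFinEquiv.injective (Fin.castLE_injective _ (Fin.succ_injective _ h))) 0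
    (fun p => Fin.succ_ne_zero _) one_pos fun a a' haa => by
      refine le_trans (le_of_eq ?_) (Finset.single_le_sum (fun j _ => sq_nonneg _)
        (Finset.mem_univ a))
      simp [haa.symm]
  have hsum : ∑ a, (μ a).real (E a) ≤ Real.exp ε + K * δ := by
    -- Any two letters differ in one data point, so all laws are compared with a single one, under
    -- which the disjoint events have total mass at most one.
    let a₀ : Fin K := ⟨0, hK0⟩
    calc ∑ a, (μ a).real (E a) ≤ ∑ a, (Real.exp ε * (μ a₀).real (E a) + δ) := by
          refine Finset.sum_le_sum fun a _ => ?_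
          simpa using hpriv 1 a a₀ (Finset.card_le_univ _)
      _ = Real.exp ε * ∑ a, (μ a₀).real (E a) + K * δ := by
          simp [Finset.sum_add_distrib, Finset.mul_sum]
      _ ≤ Real.exp ε * 1 + K * δ := by
          gcongr
          exact sum_measureReal_le_one (μ a₀) hE hdisj
      _ = Real.exp ε + K * δ := by rw [mul_one]
  by_contra! hlt
  have herr : 8 * C ^ 2 / (ε ^ 2 * 1) ≤ r * (τ / 2) := by
    have hC2 : C ^ 2 ≤ ε ^ 2 * (τ / (32 * K)) * m := by
      calc C ^ 2 ≤ (ε * Real.sqrt (τ / (32 * K)) * Real.sqrt m) ^ 2 := by gcongr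
        _ = ε ^ 2 * (τ / (32 * K)) * m := by
          rw [mul_pow, mul_pow, Real.sq_sqrt (by positivity), Real.sq_sqrt (by positivity)]
    calc 8 * C ^ 2 / (ε ^ 2 * 1)
        ≤ 8 * (ε ^ 2 * (τ / (32 * K)) * (2 * (r * K))) / (ε ^ 2 * 1) := by
          gcongr
          exact hC2.trans (by gcongr)
      _ = r * (τ / 2) := by
          field_simp
          norm_num
  simp only [Fintype.card_fin] at hscore
  have h1 : 2 / 3 * (r - r * (τ / 2)) * K ≤ r * (Real.exp ε + K * δ) :=
    le_trans (by gcongr) (hscore.trans (mul_le_mul_of_nonneg_left hsum hr0'.le))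
  have h2 : 2 / 3 * (1 - τ / 2) * K ≤ Real.exp ε + K * δ := by
    refine le_of_mul_le_mul_left (le_trans (le_of_eq ?_) h1) hr0'
    ring
  -- Since `δ = 2 / 3 - τ`, `h2` gives `2 / 3 * τ * K ≤ exp ε`, against `2 * exp ε < K * τ`.
  nlinarith

end errorFactor

end

theorem theorem5 :
    ∃ q : (N : ℕ) → Fin N → Fin N → ℝ,
      -- for `N` a power of two, `q N` are the scaled rows of a Hadamard matrix
      (∀ k : ℕ, ∃ H : Matrix (Fin (2 ^ k)) (Fin (2 ^ k)) ℝ,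
        H.IsHadamard ∧ ∀ t u, q (2 ^ k) t u = Real.sqrt 2 ^ (t : ℕ) * H t u) ∧
      -- `‖q_1‖_∞ = 1` (the norm of `Fin N → ℝ` is the sup norm)
      (∀ (N : ℕ) (hN : 0 < N), ‖q N ⟨0, hN⟩‖ = 1) ∧
      -- `log₂ γ₂(Q) = Θ(N)`
      (∃ a b : ℝ, 0 < a ∧ 0 < b ∧ ∀ N : ℕ, 2 ≤ N →
        a * N ≤ Real.logb 2 (gammaTwo (queryMatrix (q N))) ∧
        Real.logb 2 (gammaTwo (queryMatrix (q N))) ≤ b * N) ∧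
      -- `C = Ω(√(log₂ γ₂(Q)))` with absolute constants, for every `N`
      (∃ c η : ℝ, 0 < c ∧ 0 < η ∧ ∀ N : ℕ, 0 < N →
        ∀ ε δ : ℝ, 0 < ε → ε ≤ 1 → 0 ≤ δ → δ ≤ η * ε →
          ErrorFactorAtLeast.{u} (q N) ε δ c) ∧
      -- `C = Ω(√(log₂ γ₂(Q)))` as `N → ∞`, for arbitrary fixed privacy parameters
      (∀ ε δ : ℝ, 0 < ε → 0 ≤ δ → δ < 2 / 3 →
        ∃ c : ℝ, 0 < c ∧ ∃ N₀ : ℕ, ∀ N ≥ N₀, ErrorFactorAtLeast.{u} (q N) ε δ c) := by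
  choose W hW using exists_isHadamard_two_pow
  -- The Hadamard order `m + 1` is the largest power of two up to `N`, hence more than `N / 2`.
  have hrows : ∀ N : ℕ, 0 < N → ∃ (m : ℕ) (H : Matrix (Fin (m + 1)) (Fin (m + 1)) ℝ),
      H.IsHadamard ∧ m + 1 ≤ N ∧ N < 2 * (m + 1) ∧
        scaledRowQueries N (W (Nat.log 2 N)) = scaledRowQueries N H := by
    intro N hN
    have h1 : 2 ^ Nat.log 2 N ≤ N := Nat.pow_log_le_self 2 hN.ne'
    have h2 : N < 2 ^ (Nat.log 2 N + 1) := Nat.lt_pow_succ_log_self one_lt_two N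
    have h3 := hW (Nat.log 2 N)
    rw [pow_succ] at h2
    generalize W (Nat.log 2 N) = H at h3 ⊢
    revert H
    generalize 2 ^ Nat.log 2 N = M at h1 h2 ⊢
    intro H hH
    obtain ⟨m, rfl⟩ : ∃ m, M = m + 1 := ⟨M - 1, by omega⟩
    exact ⟨m, H, hH, h1, by omega, rfl⟩
  refine ⟨fun N => scaledRowQueries N (W (Nat.log 2 N)), fun k => ⟨W k, hW k, fun t u => ?_⟩,
    fun N hN => ?_, ⟨1 / 8, 1, by norm_num, one_pos, fun N hN => ?_⟩,
    ⟨1 / 100, 1 / 200, by norm_num, by norm_num, fun N hN ε δ hε hε1 hδ hδε => ?_⟩,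
    fun ε δ hε hδ hδ1 => ?_⟩
  · have hk : Nat.log 2 (2 ^ k) = k := Nat.log_pow one_lt_two k
    simp only
    rw [hk]
    exact scaledRowQueries_castLE le_rfl t u
  · obtain ⟨m, H, hH, hm, -, hq⟩ := hrows N hN
    simp only [hq]
    exact norm_scaledRowQueries_zero hH hm m.succ_pos
  · obtain ⟨m, H, hH, hm, hm2, hq⟩ := hrows N (by omega)
    simp only [hq]
    -- `N ≥ 2` forces `m ≥ 1`, and then `N ≤ 2 m + 1 ≤ 4 m`; with `m / 2 ≤ log₂ γ₂(Q)` this is the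
    -- source of `1 / 8`.
    have hle : (N : ℝ) ≤ 4 * m := by exact_mod_cast (by omega : N ≤ 4 * m)
    have hge : (m : ℝ) ≤ N := by exact_mod_cast (by omega : m ≤ N)
    have h1 := half_le_logb_gammaTwo hH hm
    have h2 := logb_gammaTwo_le hH hm
    constructor <;> linarith
  · obtain ⟨m, H, hH, hm, -, hq⟩ := hrows N hN
    simp only [hq]
    exact errorFactorAtLeast_of_le_one hH hm hε hε1 hδ hδε
  · obtain ⟨K, hK⟩ := exists_nat_gt (2 * Real.exp ε / (2 / 3 - δ))
    have hτ : 0 < 2 / 3 - δ := by linarith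
    have hK0 : (0 : ℝ) < K := lt_of_le_of_lt (by positivity) hK
    refine ⟨ε * Real.sqrt ((2 / 3 - δ) / (32 * K)), by positivity, 2 * (K + 1), fun N hN => ?_⟩
    obtain ⟨m, H, hH, hm, hm2, hq⟩ := hrows N (by omega)
    simp only [hq]
    exact errorFactorAtLeast_of_le_card hH hm hε hδ hδ1 hK (by omega)
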